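/- Let $\mathcal N$ be a finite set with $n$ elements, let $k\in\{1,\dots,n\}$, and let $f:2^{\mathcal N}\to\mathbb R_+$ be monotone and submodular with $f(\emptyset)=0$. A (randomized) algorithm produces random sets $S_1,S_2,\dots\subseteq\mathcal N$. For a vector $\mathbf r\in[0,1]^{\mathcal N}$, an algorithm is called feasible for $\mathbf r$ if $|S_t|\le k$ for all $t$ and $$\liminf_{T\to\infty}\frac1T\sum_{t=1}^T\mathbb P(u\in S_t)\ \ge\ r_u\qquad\text{for all }u\in\mathcal N ;$$ the vector $\mathbf r$ is called feasible if some algorithm is feasible for it. Let $U_{\mathrm{opt}}$ be the supremum of $\liminf_{T\to\infty}\frac1T\sum_{t=1}^T\mathbb E[f(S_t)]$ over all algorithms feasible for $\mathbf r$. Let $F(\mathbf y)=\sum_{S\subseteq\mathcal N}f(S)\prod_{u\in S}y_u\prod_{v\notin S}(1-y_v)$ be the multilinear extension of $f$, and let $P_f=\{\mathbf x\in[0,1]^{\mathcal N}:\ \mathbf r\le\mathbf x\le\mathbf 1,\ \sum_u x_u\le k\}$. The (continuous-time) algorithm FairCG1 works as follows. Step 1 (continuous greedy). Follow a trajectory $\mathbf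 y:[0,1]\to[0,1]^{\mathcal N}$ with $\mathbf y(0)=\mathbf 0$ and $\frac{d\mathbf y}{d\tau}(\tau)=\mathbf x(\tau)$, that is, $\mathbf y(\tau)=\int_0^\tau\mathbf x(s)\,ds$, where $\mathbf x$ is integrable and, for almost every $\tau$, $\mathbf x(\tau)$ maximizes $\sum_u x_u w_u(\tau)$ over $\mathbf x\in P_f$, with $w_u(\tau)=F(\mathbf y(\tau)\vee\mathbf 1_u)-F(\mathbf y(\tau))$. Here $\vee$ is the coordinatewise maximum and $\mathbf 1_u$ the $u$-th standard basis vector. Ties are broken so that $\sum_u x_u(\tau)=k$. Step 2 (randomized dependent rounding). In every round $t=1,2,\dots$, with fresh independent randomness, start from the vector $\mathbf y=\mathbf y(1)$ and, as long as some coordinate lies in $(0,1)$, choose $u\ne v$ with $y_u,y_v\in(0,1)$ in an arbitrary way, put $a=\min\{1-y_u,y_v\}$ and $b=\min\{y_u,1-y_v\}$, and replace $(y_u,y_v)$ by $(y_u+a,\,y_v-a)$ with probability $\frac b{a+b}$ and by $(y_u-b,\,y_v+b)$ with probability $\frac a{a+b}$. When all coordinates are integral, output $S_t=\{u: y_u=1\}$.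 Theorem. For every feasible $\mathbf r$, FairCG1 can be run (a trajectory and rounding choices as above exist), and for every run of it $$\liminf_{T\to\infty}\frac1T\sum_{t=1}^T\mathbb E[f(S_t)]\ \ge\ \Bigl(1-\frac1e\Bigr)U_{\mathrm{opt}} .$$ -/

import Mathlib

open MeasureTheory ProbabilityTheory Filter

noncomputable section

namespace FairSubmodular

/-- Submodularity of a set function (decreasing marginal gains). -/
def Submodular {N : Type*} [DecidableEq N] (f : Finset N → ℝ) : Prop :=
  ∀ A B : Finset N, A ⊆ B → ∀ u ∉ B, f (insert u B) - f B ≤ f (insert u A) - f A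

/-! ### The multi-round problem

A (randomized) algorithm is represented by the law `μ` of the sequence of sets it selects, a
probability measure on `ℕ → Finset N` (with Mathlib's product sigma-algebra; for finite `N` every
set of worker sets is measurable); rounds are numbered from `0`. -/

/-- Long-run expected time-average utility: the lower limit as `T → ∞` of
`(1 / T) * ∑_{t < T} E[f (S_t)]`. -/
def avgUtility {N : Type*} (f : Finset N → ℝ) (μ : Measure (ℕ → Finset N)) : ℝ :=
  liminf (fun T : ℕ => (1 / (T : ℝ)) * ∑ t ∈ Finset.range T, ∫ S, f (S t) ∂μ) atTop

/-- Long-run expected fraction of rounds in which `u` is selected: the lower limit as `T → ∞` of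
`(1 / T) * ∑_{t < T} P(u ∈ S_t)`. -/
def selectionFraction {N : Type*} (μ : Measure (ℕ → Finset N)) (u : N) : ℝ :=
  liminf (fun T : ℕ => (1 / (T : ℝ)) * ∑ t ∈ Finset.range T, μ.real {S | u ∈ S t}) atTop

/-- The algorithm with law `μ` always selects at most `k` elements per round and meets the
long-term fairness requirement `r`. -/
structure IsFeasiblePolicy {N : Type*} (r : N → ℝ) (k : ℕ) (μ : Measure (ℕ → Finset N)) :
    Prop where
  isProbabilityMeasure : IsProbabilityMeasure μ
  card_le : ∀ᵐ S ∂μ, ∀ t, (S t).card ≤ k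
  fair : ∀ u, r u ≤ selectionFraction μ u

/-- The requirement vector `r ∈ [0,1]^N` is feasible: some algorithm meets it. -/
def FeasibleRequirement {N : Type*} (r : N → ℝ) (k : ℕ) : Prop :=
  (∀ u, r u ∈ Set.Icc (0 : ℝ) 1) ∧ ∃ μ : Measure (ℕ → Finset N), IsFeasiblePolicy r k μ

/-- The optimal value of the multi-round problem: the supremum of the time-average utility over
all feasible algorithms. -/
def Uopt {N : Type*} (f : Finset N → ℝ) (r : N → ℝ) (k : ℕ) : ℝ :=
  sSup {U | ∃ μ : Measure (ℕ → Finset N), IsFeasiblePolicy r k μ ∧ U = avgUtility f μ}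

/-! ### Step 1: continuous greedy -/

/-- The multilinear extension of a set function. -/
def multilinearExt {N : Type*} [Fintype N] [DecidableEq N] (f : Finset N → ℝ) (y : N → ℝ) : ℝ :=
  ∑ S : Finset N, f S * (∏ u ∈ S, y u) * ∏ v ∈ Sᶜ, (1 - y v)

/-- The polytope `{x : r ≤ x ≤ 1, ∑ x ≤ k}`. -/
def fairPolytope {N : Type*} [Fintype N] (r : N → ℝ) (k : ℕ) : Set (N → ℝ) :=
  {x | (∀ u, r u ≤ x u) ∧ (∀ u, x u ∈ Set.Icc (0 : ℝ) 1) ∧ ∑ u, x u ≤ k}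

/-- The weights `w_u = F (y ∨ 1_u) - F y`. -/
def greedyWeight {N : Type*} [Fintype N] [DecidableEq N] (f : Finset N → ℝ) (y : N → ℝ) (u : N) :
    ℝ :=
  multilinearExt f (y ⊔ Pi.single u 1) - multilinearExt f y

/-- `x` is an admissible direction at the point `y`: a maximizer of `x ↦ ∑ u, x u * w_u` over the
polytope which exhausts the budget, `∑ x = k`. (The weights are nonnegative for monotone `f`, so
such maximizers exist; when some weights vanish there may also be others with `∑ x < k`.) -/
structure IsGreedyDirection {N : Type*} [Fintype N] [DecidableEq N] (f : Finset N → ℝ)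
    (r : N → ℝ) (k : ℕ) (y x : N → ℝ) : Prop where
  mem : x ∈ fairPolytope r k
  isMaxOn : IsMaxOn (fun z : N → ℝ => ∑ u, z u * greedyWeight f y u) (fairPolytope r k) x
  sum_eq : ∑ u, x u = k

/-- A trajectory `y : [0,1] → ℝ^N` of the continuous greedy process: `y 0 = 0` and
`dy/dτ = x τ` with `x τ` an admissible direction at `y τ`, for almost every `τ`, in the integrated
(Carathéodory) form `y τ = ∫_0^τ x`. -/
def IsGreedyPath {N : Type*} [Fintype N] [DecidableEq N] (f : Finset N → ℝ) (r : N → ℝ) (k : ℕ)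
    (y : ℝ → N → ℝ) : Prop :=
  ∃ x : ℝ → N → ℝ, IntervalIntegrable x volume 0 1 ∧
    (∀ᵐ τ ∂(volume.restrict (Set.Icc (0 : ℝ) 1)), IsGreedyDirection f r k (y τ) (x τ)) ∧
    ∀ τ ∈ Set.Icc (0 : ℝ) 1, y τ = ∫ s in (0 : ℝ)..τ, x s

/-! ### Step 2: randomized dependent rounding -/

/-- Move mass `c` from coordinate `v` to coordinate `u`. -/
def shift {N : Type*} [DecidableEq N] (y : N → ℝ) (u v : N) (c : ℝ) : N → ℝ :=
  y + Pi.single u c - Pi.single v c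

open Classical in
/-- `DepRounding y ν`: the law of the random set returned by dependent rounding, started from the
vector `y`, is `ν` for some way of choosing the pairs `u ≠ v` (the choice may depend on the whole
history). If no coordinate lies in `(0,1)`, the set `{u | y u = 1}` is returned. Otherwise, with
`a = min (1 - y u) (y v)` and `b = min (y u) (1 - y v)`, the pair `(y u, y v)` is replaced by
`(y u + a, y v - a)` with probability `b / (a + b)` and by `(y u - b, y v + b)` with probability
`a / (a + b)`, and the loop continues. -/
inductive DepRounding {N : Type*} [Fintype N] : (N → ℝ) → Measure (Finset N) → Prop
  | done (y : N → ℝ) (h : ∀ u, y u ∉ Set.Ioo (0 : ℝ) 1) :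
      DepRounding y (Measure.dirac (Finset.univ.filter fun u => y u = 1))
  | step (y : N → ℝ) (u v : N) (huv : u ≠ v)
      (hu : y u ∈ Set.Ioo (0 : ℝ) 1) (hv : y v ∈ Set.Ioo (0 : ℝ) 1)
      (a b : ℝ) (ha : a = min (1 - y u) (y v)) (hb : b = min (y u) (1 - y v))
      (ν₁ ν₂ : Measure (Finset N))
      (h₁ : DepRounding (shift y u v a) ν₁) (h₂ : DepRounding (shift y u v (-b)) ν₂) :
      DepRounding y (ENNReal.ofReal (b / (a + b)) • ν₁ + ENNReal.ofReal (a / (a + b)) • ν₂)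

/-! ### The algorithm -/

/-- `μ` is the law of the sequence of sets produced by a run of the fair continuous greedy
algorithm: a trajectory `y` of the continuous greedy process is followed up to time `1`, and then,
in every round, dependent rounding is applied to `y 1` with fresh randomness. -/
structure IsFairCG1 {N : Type*} [Fintype N] [DecidableEq N] (f : Finset N → ℝ) (r : N → ℝ)
    (k : ℕ) (μ : Measure (ℕ → Finset N)) : Prop where
  isProbabilityMeasure : IsProbabilityMeasure μ
  indep : iIndepFun (fun (t : ℕ) (S : ℕ → Finset N) => S t) μ
  rounding : ∃ y : ℝ → N → ℝ, IsGreedyPath f r k y ∧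
    ∀ t : ℕ, DepRounding (y 1) (μ.map fun S => S t)

end FairSubmodular

end

/-! Write F for the multilinear extension and w(p) for the greedy weights at p. Submodularity and
monotonicity give f(A) ≤ F(p) + ∑_{u ∈ A} w_u(p) at every point p of the cube. Averaging over the
rounds of a feasible policy and passing to a limit point z of its selection frequencies puts z in
the polytope and bounds its utility U by F(p) + ⟨z, w(p)⟩, with one z for all p
(`IsFeasiblePolicy.exists_mem_fairPolytope`). Along a greedy path with direction x, the derivative
of F is at least ⟨x, w⟩ ≥ ⟨z, w⟩ ≥ U - F. Hence e^τ (F(y τ) - U) is nondecreasing, which gives F(y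
1) ≥ (1 - 1/e) U (`IsGreedyPath.le_multilinearExt`). Rounding loses nothing in expectation: each
move preserves the mean, and F is convex along 1_u - 1_v (`multilinearExt_le_shift`).

Existence is a separate matter. The greedy direction is in general discontinuous in the position, so
the path is built as a limit of Euler schemes (`exists_krasovskii_path`). Where it is
differentiable, its derivative lies in every closed convex set containing the greedy directions at
nearby points, and those are all nearly optimal at y τ. Rounding terminates because the coordinate
sum stays equal to the integer k, so a fractional coordinate always has a partner
(`exists_depRounding`). -/

open scoped Topology

namespace FairSubmodular

/-! ### Inequalities for submodular set functions. -/

section Submodular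

variable {N : Type*} [DecidableEq N]

/-- Adding the elements of `A` one at a time, each gain is at most the gain over `S` alone; elements
already in `S` contribute zero. -/
theorem Submodular.union_le {f : Finset N → ℝ} (hsub : Submodular f) (S A : Finset N) :
    f (S ∪ A) ≤ f S + ∑ u ∈ A, (f (insert u S) - f S) := by
  induction A using Finset.induction_on with
  | empty => simp
  | insert u A hu ih =>
    rw [Finset.sum_insert hu, Finset.union_insert]
    have key : f (insert u (S ∪ A)) - f (S ∪ A) ≤ f (insert u S) - f S := by
      by_cases h : u ∈ S ∪ A
      · have hS : u ∈ S := (Finset.mem_union.1 h).resolve_right hu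
        rw [Finset.insert_eq_of_mem h, Finset.insert_eq_of_mem hS, sub_self, sub_self]
      · exact hsub S (S ∪ A) Finset.subset_union_left u h
    linarith

/-- Mixed second differences of a submodular function are nonpositive. -/
theorem Submodular.mixed_difference_nonpos {f : Finset N → ℝ} (hsub : Submodular f) {u v : N}
    (huv : u ≠ v) (S : Finset N) :
    f (insert v (insert u S)) + f ((S.erase u).erase v) ≤
      f ((insert u S).erase v) + f (insert v (S.erase u)) := by
  have h := hsub ((S.erase u).erase v) (insert v (S.erase u))
    ((Finset.erase_subset _ _).trans (Finset.subset_insert _ _)) u (by simp [huv])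
  have h₁ : insert u (insert v (S.erase u)) = insert v (insert u S) := by
    ext w
    simp only [Finset.mem_insert, Finset.mem_erase]
    tauto
  have h₂ : insert u ((S.erase u).erase v) = (insert u S).erase v := by
    ext w
    simp only [Finset.mem_insert, Finset.mem_erase]
    rcases eq_or_ne w u with rfl | hw
    · simp [huv]
    · simp only [hw]
      tauto
  rw [h₁, h₂] at h
  linarith

end Submodular

/-! ### The multilinear extension: affine structure, derivative, linear upper bound. -/

section Multilinear

variable {N : Type*} [Fintype N] [DecidableEq N]

/-- The probability that the random set which contains each `u` independently with probability
`y u` equals `S`. -/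
def inclusionWeight (y : N → ℝ) (S : Finset N) : ℝ :=
  ∏ u, if u ∈ S then y u else 1 - y u

theorem multilinearExt_eq_sum (f : Finset N → ℝ) (y : N → ℝ) :
    multilinearExt f y = ∑ S, inclusionWeight y S * f S := by
  refine Finset.sum_congr rfl fun S _ => ?_
  have h : inclusionWeight y S = (∏ u ∈ S, y u) * ∏ v ∈ Sᶜ, (1 - y v) := by
    rw [inclusionWeight, Finset.prod_ite]
    congr 1
    · simp
    · congr 1
      ext v
      simp
  rw [h]
  ring

theorem inclusionWeight_nonneg {y : N → ℝ} (hy : ∀ u, y u ∈ Set.Icc (0 : ℝ) 1) (S : Finset N) :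
    0 ≤ inclusionWeight y S := by
  refine Finset.prod_nonneg fun u _ => ?_
  split_ifs
  · exact (hy u).1
  · linarith [(hy u).2]

theorem sum_inclusionWeight (y : N → ℝ) : ∑ S, inclusionWeight y S = 1 := by
  have h := Finset.prod_add y (fun u => 1 - y u) Finset.univ
  simp only [add_sub_cancel, Finset.prod_const_one, Finset.powerset_univ] at h
  rw [h]
  refine Finset.sum_congr rfl fun S _ => ?_
  rw [inclusionWeight, Finset.prod_ite]
  congr 1
  · simp
  · congr 1
    ext v
    simp

theorem multilinearExt_const (c : ℝ) (y : N → ℝ) :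
    multilinearExt (fun _ : Finset N => c) y = c := by
  rw [multilinearExt_eq_sum, ← Finset.sum_mul, sum_inclusionWeight, one_mul]

theorem multilinearExt_mono {f g : Finset N → ℝ} (hfg : ∀ S, f S ≤ g S) {y : N → ℝ}
    (hy : ∀ u, y u ∈ Set.Icc (0 : ℝ) 1) : multilinearExt f y ≤ multilinearExt g y := by
  rw [multilinearExt_eq_sum, multilinearExt_eq_sum]
  exact Finset.sum_le_sum fun S _ =>
    mul_le_mul_of_nonneg_left (hfg S) (inclusionWeight_nonneg hy S)

theorem multilinearExt_add (f g : Finset N → ℝ) (y : N → ℝ) :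
    multilinearExt (fun S => f S + g S) y = multilinearExt f y + multilinearExt g y := by
  simp only [multilinearExt_eq_sum, mul_add, Finset.sum_add_distrib]

theorem multilinearExt_sub (f g : Finset N → ℝ) (y : N → ℝ) :
    multilinearExt (fun S => f S - g S) y = multilinearExt f y - multilinearExt g y := by
  simp only [multilinearExt_eq_sum, mul_sub, Finset.sum_sub_distrib]

theorem multilinearExt_sum {ι : Type*} (s : Finset ι) (f : ι → Finset N → ℝ) (y : N → ℝ) :
    multilinearExt (fun S => ∑ i ∈ s, f i S) y = ∑ i ∈ s, multilinearExt (f i) y := by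
  simp only [multilinearExt_eq_sum, Finset.mul_sum]
  exact Finset.sum_comm

/-- Pairs the sets that differ only in `u`; this is what isolates the dependence on one coordinate.
-/
theorem sum_finset_eq_sum_erase_insert (u : N) (g : Finset N → ℝ) :
    ∑ S, g S = ∑ S ∈ (Finset.univ.erase u).powerset, (g S + g (insert u S)) := by
  rw [Finset.sum_add_distrib, ← Finset.sum_powerset_insert (Finset.notMem_erase u _),
    Finset.insert_erase (Finset.mem_univ u), Finset.powerset_univ]

theorem inclusionWeight_update_of_notMem (y : N → ℝ) (u : N) (c : ℝ) {S : Finset N} (hu : u ∉ S) :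
    inclusionWeight (Function.update y u c) S =
      (1 - c) * ∏ v ∈ Finset.univ.erase u, if v ∈ S then y v else 1 - y v := by
  rw [inclusionWeight, ← Finset.mul_prod_erase _ _ (Finset.mem_univ u)]
  congr 1
  · simp [hu]
  · refine Finset.prod_congr rfl fun v hv => ?_
    rw [Function.update_of_ne (Finset.ne_of_mem_erase hv)]

theorem inclusionWeight_update_insert (y : N → ℝ) (u : N) (c : ℝ) (S : Finset N) :
    inclusionWeight (Function.update y u c) (insert u S) =
      c * ∏ v ∈ Finset.univ.erase u, if v ∈ S then y v else 1 - y v := by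
  rw [inclusionWeight, ← Finset.mul_prod_erase _ _ (Finset.mem_univ u)]
  congr 1
  · simp
  · refine Finset.prod_congr rfl fun v hv => ?_
    rw [Function.update_of_ne (Finset.ne_of_mem_erase hv)]
    simp only [Finset.mem_insert, Finset.ne_of_mem_erase hv, false_or]

/-- The multilinear extension is affine in each coordinate. -/
theorem multilinearExt_update (f : Finset N → ℝ) (y : N → ℝ) (u : N) (c : ℝ) :
    multilinearExt f (Function.update y u c) =
      c * multilinearExt (fun S => f (insert u S)) y +
        (1 - c) * multilinearExt (fun S => f (S.erase u)) y := by
  rw [← Function.update_eq_self u y]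
  simp only [Function.update_idem, multilinearExt_eq_sum]
  rw [sum_finset_eq_sum_erase_insert u, sum_finset_eq_sum_erase_insert u,
    sum_finset_eq_sum_erase_insert u, Finset.mul_sum, Finset.mul_sum, ← Finset.sum_add_distrib]
  refine Finset.sum_congr rfl fun S hS => ?_
  have hu : u ∉ S := fun h => Finset.notMem_erase u _ (Finset.mem_powerset.1 hS h)
  rw [inclusionWeight_update_of_notMem _ _ _ hu, inclusionWeight_update_of_notMem _ _ _ hu,
    inclusionWeight_update_insert, inclusionWeight_update_insert, Finset.insert_idem,
    Finset.erase_insert hu, Finset.erase_eq_of_notMem hu]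
  ring

theorem multilinearExt_update_one (f : Finset N → ℝ) (y : N → ℝ) (u : N) :
    multilinearExt f (Function.update y u 1) = multilinearExt (fun S => f (insert u S)) y := by
  rw [multilinearExt_update]
  ring

/-- The expected marginal gain of `u` over the random set with marginals `y`. -/
def expectedGain (f : Finset N → ℝ) (y : N → ℝ) (u : N) : ℝ :=
  multilinearExt (fun S => f (insert u S)) y - multilinearExt f y

/-- Inside the cube the join with 1_u only resets coordinate `u` to 1. Outside it the two may
differ, and `expectedGain` is the polynomial one. -/
theorem greedyWeight_eq_expectedGain (f : Finset N → ℝ) {y : N → ℝ}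
    (hy : ∀ u, y u ∈ Set.Icc (0 : ℝ) 1) (u : N) :
    greedyWeight f y u = expectedGain f y u := by
  have h : y ⊔ Pi.single u 1 = Function.update y u 1 := by
    ext v
    rcases eq_or_ne v u with rfl | hv
    · simpa using (hy v).2
    · simpa [hv] using (hy v).1
  rw [greedyWeight, expectedGain, h, multilinearExt_update_one]

theorem expectedGain_nonneg {f : Finset N → ℝ} (hf : Monotone f) {y : N → ℝ}
    (hy : ∀ u, y u ∈ Set.Icc (0 : ℝ) 1) (u : N) : 0 ≤ expectedGain f y u :=
  sub_nonneg.2 (multilinearExt_mono (fun S => hf (Finset.subset_insert u S)) hy)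

theorem contDiff_multilinearExt (f : Finset N → ℝ) : ContDiff ℝ 1 (multilinearExt f) := by
  unfold multilinearExt
  refine ContDiff.sum fun S _ => ContDiff.mul (ContDiff.mul contDiff_const ?_) ?_
  · exact contDiff_prod fun u _ => contDiff_apply ℝ ℝ u
  · exact contDiff_prod fun u _ => contDiff_const.sub (contDiff_apply ℝ ℝ u)

theorem continuous_multilinearExt (f : Finset N → ℝ) : Continuous (multilinearExt f) :=
  (contDiff_multilinearExt f).continuous

theorem continuous_expectedGain (f : Finset N → ℝ) (u : N) :
    Continuous fun y => expectedGain f y u :=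
  (continuous_multilinearExt _).sub (continuous_multilinearExt f)

/-- Restricted to coordinate `u` the extension is affine, so the partial derivative is its slope. -/
theorem fderiv_multilinearExt_single (f : Finset N → ℝ) (y : N → ℝ) (u : N) :
    fderiv ℝ (multilinearExt f) y (Pi.single u 1) =
      multilinearExt (fun S => f (insert u S)) y - multilinearExt (fun S => f (S.erase u)) y := by
  have hF : HasFDerivAt (multilinearExt f) (fderiv ℝ (multilinearExt f) y)
      (Function.update y u (y u)) := by
    rw [Function.update_eq_self]
    exact ((contDiff_multilinearExt f).differentiable one_ne_zero y).hasFDerivAt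
  have h₁ := hF.comp_hasDerivAt (y u) (hasDerivAt_update y u (y u))
  have h₂ : HasDerivAt (fun c : ℝ => c * multilinearExt (fun S => f (insert u S)) y +
      (1 - c) * multilinearExt (fun S => f (S.erase u)) y)
      (1 * multilinearExt (fun S => f (insert u S)) y +
        (-1) * multilinearExt (fun S => f (S.erase u)) y) (y u) :=
    ((hasDerivAt_id (y u)).mul_const _).add (((hasDerivAt_id (y u)).const_sub 1).mul_const _)
  have h₃ : (multilinearExt f ∘ Function.update y u) = fun c : ℝ =>
      c * multilinearExt (fun S => f (insert u S)) y +
      (1 - c) * multilinearExt (fun S => f (S.erase u)) y :=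
    funext fun c => multilinearExt_update f y u c
  rw [h₃] at h₁
  rw [h₁.unique h₂]
  ring

/-- The directional derivative in a nonnegative direction dominates the weighted expected
gains. -/
theorem sum_mul_expectedGain_le_fderiv {f : Finset N → ℝ} (hf : Monotone f) {y x : N → ℝ}
    (hy : ∀ u, y u ∈ Set.Icc (0 : ℝ) 1) (hx : ∀ u, 0 ≤ x u) :
    ∑ u, x u * expectedGain f y u ≤ fderiv ℝ (multilinearExt f) y x := by
  have hsum : x = ∑ u, x u • (Pi.single u 1 : N → ℝ) := by
    simpa using (pi_eq_sum_univ' x)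
  conv_rhs => rw [hsum]
  rw [map_sum]
  refine Finset.sum_le_sum fun u _ => ?_
  rw [map_smul, fderiv_multilinearExt_single, smul_eq_mul]
  refine mul_le_mul_of_nonneg_left (sub_le_sub_left ?_ _) (hx u)
  exact multilinearExt_mono (fun S => hf (Finset.erase_subset u S)) hy

/-- The value of any set is bounded by its linearization at `y`. -/
theorem le_multilinearExt_add_sum_expectedGain {f : Finset N → ℝ} (hmono : Monotone f)
    (hsub : Submodular f) {y : N → ℝ} (hy : ∀ u, y u ∈ Set.Icc (0 : ℝ) 1) (A : Finset N) :
    f A ≤ multilinearExt f y + ∑ u ∈ A, expectedGain f y u := by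
  have h := multilinearExt_mono (f := fun _ => f A)
    (g := fun S => f S + ∑ u ∈ A, (f (insert u S) - f S))
    (fun S => (hmono Finset.subset_union_right).trans (hsub.union_le S A)) hy
  rw [multilinearExt_const, multilinearExt_add, multilinearExt_sum] at h
  simpa only [multilinearExt_sub, expectedGain] using h

theorem multilinearExt_indicator (f : Finset N → ℝ) (A : Finset N) :
    multilinearExt f (fun u => if u ∈ A then 1 else 0) = f A := by
  rw [multilinearExt_eq_sum, Finset.sum_eq_single A]
  · have : inclusionWeight (fun u => if u ∈ A then (1 : ℝ) else 0) A = 1 :=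
      Finset.prod_eq_one fun u _ => by by_cases h : u ∈ A <;> simp [h]
    rw [this, one_mul]
  · intro S _ hS
    obtain ⟨u, hu⟩ : ∃ u, ¬(u ∈ S ↔ u ∈ A) := by
      by_contra! h
      exact hS (Finset.ext h)
    have : inclusionWeight (fun u => if u ∈ A then (1 : ℝ) else 0) S = 0 := by
      refine Finset.prod_eq_zero (Finset.mem_univ u) ?_
      by_cases h₁ : u ∈ S <;> by_cases h₂ : u ∈ A <;> simp_all
    rw [this, zero_mul]
  · simp

end Multilinear

/-! ### Dependent rounding: expected value and termination. -/

section FractionalCoords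

variable {N : Type*} [Fintype N]

/-- The coordinates which dependent rounding still has to round. -/
noncomputable def fractionalCoords (y : N → ℝ) : Finset N :=
  open Classical in Finset.univ.filter fun w => y w ∈ Set.Ioo (0 : ℝ) 1

theorem mem_fractionalCoords {y : N → ℝ} {w : N} :
    w ∈ fractionalCoords y ↔ y w ∈ Set.Ioo (0 : ℝ) 1 := by
  simp [fractionalCoords]

end FractionalCoords

section Rounding

variable {N : Type*} [hN : DecidableEq N]

theorem shift_apply_left (y : N → ℝ) {u v : N} (huv : u ≠ v) (c : ℝ) :
    shift y u v c u = y u + c := by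
  simp [shift, huv]

theorem shift_apply_right (y : N → ℝ) {u v : N} (huv : u ≠ v) (c : ℝ) :
    shift y u v c v = y v - c := by
  simp [shift, huv]

theorem shift_apply_of_ne (y : N → ℝ) {u v w : N} (hu : w ≠ u) (hv : w ≠ v) (c : ℝ) :
    shift y u v c w = y w := by
  simp [shift, hu, hv]

theorem shift_eq_update (y : N → ℝ) {u v : N} (huv : u ≠ v) (c : ℝ) :
    shift y u v c = Function.update (Function.update y u (y u + c)) v (y v - c) := by
  ext w
  rcases eq_or_ne w v with rfl | hv
  · rw [shift_apply_right y huv, Function.update_self]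
  · rw [Function.update_of_ne hv]
    rcases eq_or_ne w u with rfl | hu
    · rw [shift_apply_left y huv, Function.update_self]
    · rw [Function.update_of_ne hu, shift_apply_of_ne y hu hv]

theorem shift_zero (y : N → ℝ) (u v : N) : shift y u v 0 = y := by
  simp [shift]

theorem shift_mem_cube {y : N → ℝ} (hy : ∀ w, y w ∈ Set.Icc (0 : ℝ) 1) {u v : N} (huv : u ≠ v)
    {c : ℝ} (hu : y u + c ∈ Set.Icc (0 : ℝ) 1) (hv : y v - c ∈ Set.Icc (0 : ℝ) 1) (w : N) :
    shift y u v c w ∈ Set.Icc (0 : ℝ) 1 := by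
  rcases eq_or_ne w v with rfl | hwv
  · rwa [shift_apply_right y huv]
  rcases eq_or_ne w u with rfl | hwu
  · rwa [shift_apply_left y huv]
  · rw [shift_apply_of_ne y hwu hwv]
    exact hy w

variable [Fintype N]

theorem sum_shift (y : N → ℝ) (u v : N) (c : ℝ) : ∑ w, shift y u v c w = ∑ w, y w := by
  simp [shift, Finset.sum_add_distrib, Finset.sum_sub_distrib]

/-- The multilinear extension of a submodular function is convex in the direction `1_u - 1_v`:
it does not decrease in expectation in a mean-preserving move along that direction. -/
theorem multilinearExt_le_shift {f : Finset N → ℝ} (hsub : Submodular f) {y : N → ℝ}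
    (hy : ∀ w, y w ∈ Set.Icc (0 : ℝ) 1) {u v : N} (huv : u ≠ v) {p q a b : ℝ} (hp : 0 ≤ p)
    (hq : 0 ≤ q) (hpq : p + q = 1) (hab : p * a = q * b) :
    multilinearExt f y ≤
      p * multilinearExt f (shift y u v a) + q * multilinearExt f (shift y u v (-b)) := by
  have hexp : ∀ c, multilinearExt f (shift y u v c) =
      (y v - c) * ((y u + c) * multilinearExt (fun S => f (insert v (insert u S))) y +
        (1 - (y u + c)) * multilinearExt (fun S => f (insert v (S.erase u))) y) +
      (1 - (y v - c)) * ((y u + c) * multilinearExt (fun S => f ((insert u S).erase v)) y +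
        (1 - (y u + c)) * multilinearExt (fun S => f ((S.erase u).erase v)) y) := by
    intro c
    rw [shift_eq_update y huv, multilinearExt_update, multilinearExt_update _ y u,
      multilinearExt_update _ y u]
  have hmixed := multilinearExt_mono (hsub.mixed_difference_nonpos huv) hy
  rw [multilinearExt_add, multilinearExt_add] at hmixed
  have h₀ := hexp 0
  rw [shift_zero] at h₀
  rw [h₀, hexp a, hexp (-b)]
  set P := multilinearExt (fun S => f (insert v (insert u S))) y
  set Q := multilinearExt (fun S => f (insert v (S.erase u))) y
  set R := multilinearExt (fun S => f ((insert u S).erase v)) y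
  set T := multilinearExt (fun S => f ((S.erase u).erase v)) y
  -- Along the shift F is a quadratic in `c` with leading coefficient R + Q - P - T. The linear term
  -- cancels by `hab`, so this product is exactly the gap between the two sides.
  have hsq : 0 ≤ (R + Q - P - T) * (p * a ^ 2 + q * b ^ 2) :=
    mul_nonneg (by linarith) (by positivity)
  refine le_of_sub_nonneg (hsq.trans_eq ?_)
  linear_combination
    (-(y v * (y u * P + (1 - y u) * Q) + (1 - y v) * (y u * R + (1 - y u) * T))) * hpq -
      (y v * (P - Q) - (y u * P + (1 - y u) * Q) + (1 - y v) * (R - T) +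
        (y u * R + (1 - y u) * T)) * hab

/-- Induction over the tree of rounding moves, all of which stay in the cube. At a leaf `y` is the
indicator of the returned set, where F agrees with `f`. -/
theorem DepRounding.isProbabilityMeasure_and_le_integral {f : Finset N → ℝ}
    (hsub : Submodular f) {y : N → ℝ} {ν : Measure (Finset N)} (h : DepRounding y ν)
    (hy : ∀ w, y w ∈ Set.Icc (0 : ℝ) 1) :
    IsProbabilityMeasure ν ∧ multilinearExt f y ≤ ∫ S, f S ∂ν := by
  -- `DepRounding` shifts with classical decidable equality; the ambient instance has to be
  -- identified with it.
  obtain rfl : hN = fun a b => Classical.propDecidable (a = b) := Subsingleton.elim _ _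
  classical
  induction h with
  | done y h =>
    refine ⟨inferInstance, ?_⟩
    rw [integral_dirac, ← multilinearExt_indicator f]
    refine le_of_eq (congrArg _ (funext fun w => ?_))
    have hw := hy w
    have hw' := h w
    simp only [Finset.mem_filter, Finset.mem_univ, true_and]
    split_ifs with h₁
    · exact h₁
    · by_contra h₀
      exact hw' ⟨lt_of_le_of_ne hw.1 (Ne.symm h₀), lt_of_le_of_ne hw.2 h₁⟩
  | step y u v huv hu hv a b ha hb ν₁ ν₂ _ _ ih₁ ih₂ =>
    have ha₀ : 0 < a := ha ▸ lt_min (sub_pos.2 hu.2) hv.1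
    have hb₀ : 0 < b := hb ▸ lt_min hu.1 (sub_pos.2 hv.2)
    have ha₁ : a ≤ 1 - y u := ha ▸ min_le_left _ _
    have ha₂ : a ≤ y v := ha ▸ min_le_right _ _
    have hb₁ : b ≤ y u := hb ▸ min_le_left _ _
    have hb₂ : b ≤ 1 - y v := hb ▸ min_le_right _ _
    obtain ⟨hν₁, h₁⟩ := ih₁ (shift_mem_cube (c := a) hy huv
      ⟨by linarith [hu.1], by linarith⟩ ⟨by linarith, by linarith [hv.2]⟩)
    obtain ⟨hν₂, h₂⟩ := ih₂ (shift_mem_cube (c := -b) hy huv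
      ⟨by linarith, by linarith [hu.2]⟩ ⟨by linarith [hv.1], by linarith⟩)
    have hp : 0 ≤ b / (a + b) := by positivity
    have hq : 0 ≤ a / (a + b) := by positivity
    have hpq : b / (a + b) + a / (a + b) = 1 := by
      rw [← add_div, add_comm b a, div_self (by positivity)]
    refine ⟨⟨?_⟩, ?_⟩
    · simp only [Measure.coe_add, Measure.coe_smul, Pi.add_apply, Pi.smul_apply, measure_univ,
        smul_eq_mul, mul_one]
      rw [← ENNReal.ofReal_add hp hq, hpq, ENNReal.ofReal_one]
    · rw [integral_add_measure (Integrable.of_finite.smul_measure ENNReal.ofReal_ne_top)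
        (Integrable.of_finite.smul_measure ENNReal.ofReal_ne_top), integral_smul_measure,
        integral_smul_measure, ENNReal.toReal_ofReal hp, ENNReal.toReal_ofReal hq, smul_eq_mul,
        smul_eq_mul]
      refine (multilinearExt_le_shift (a := a) (b := b) hsub hy huv hp hq hpq (by ring)).trans ?_
      exact add_le_add (mul_le_mul_of_nonneg_left h₁ hp) (mul_le_mul_of_nonneg_left h₂ hq)

/-- The termination measure: only `u` and `v` change, both were fractional, and one of them becomes
integral. -/
theorem card_fractionalCoords_shift_lt {y : N → ℝ} {u v : N} (huv : u ≠ v)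
    (hu : y u ∈ Set.Ioo (0 : ℝ) 1) (hv : y v ∈ Set.Ioo (0 : ℝ) 1) {c : ℝ}
    (hc : shift y u v c u ∉ Set.Ioo (0 : ℝ) 1 ∨ shift y u v c v ∉ Set.Ioo (0 : ℝ) 1) :
    (fractionalCoords (shift y u v c)).card < (fractionalCoords y).card := by
  refine Finset.card_lt_card ((Finset.ssubset_iff_of_subset fun w hw => ?_).2 ?_)
  · rw [mem_fractionalCoords] at hw ⊢
    rcases eq_or_ne w u with rfl | hwu
    · exact hu
    rcases eq_or_ne w v with rfl | hwv
    · exact hv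
    · rwa [shift_apply_of_ne y hwu hwv] at hw
  · rcases hc with hc | hc
    · exact ⟨u, mem_fractionalCoords.2 hu, fun h => hc (mem_fractionalCoords.1 h)⟩
    · exact ⟨v, mem_fractionalCoords.2 hv, fun h => hc (mem_fractionalCoords.1 h)⟩

/-- A vector of the cube with integral coordinate sum does not have exactly one fractional
coordinate. -/
theorem exists_ne_fractional {y : N → ℝ} (hy : ∀ w, y w ∈ Set.Icc (0 : ℝ) 1) {k : ℤ}
    (hk : ∑ w, y w = k) {u : N} (hu : y u ∈ Set.Ioo (0 : ℝ) 1) :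
    ∃ v, u ≠ v ∧ y v ∈ Set.Ioo (0 : ℝ) 1 := by
  by_contra! h
  have hint : ∀ v ∈ Finset.univ.erase u, y v = ((if y v = 1 then 1 else 0 : ℤ) : ℝ) := by
    intro v hv
    have hv' := h v (Finset.ne_of_mem_erase hv).symm
    split_ifs with h₁
    · simpa using h₁
    · by_contra h₀
      rw [Int.cast_zero] at h₀
      exact hv' ⟨lt_of_le_of_ne (hy v).1 (Ne.symm h₀), lt_of_le_of_ne (hy v).2 h₁⟩
  -- All other coordinates being 0 or 1, `y u` is a difference of integers, yet strictly between 0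
  -- and 1.
  rw [← Finset.add_sum_erase _ _ (Finset.mem_univ u), Finset.sum_congr rfl hint,
    ← Int.cast_sum] at hk
  have huz := eq_sub_of_add_eq hk
  rw [← Int.cast_sub] at huz
  rw [huz, Set.mem_Ioo, ← Int.cast_one, ← Int.cast_zero, Int.cast_lt, Int.cast_lt] at hu
  omega

end Rounding

theorem exists_depRounding {N : Type*} [Fintype N] {y : N → ℝ} (hy : ∀ w, y w ∈ Set.Icc (0 : ℝ) 1) {k : ℤ}
    (hk : ∑ w, y w = k) : ∃ ν, DepRounding y ν := by
  classical
  induction hn : (fractionalCoords y).card using Nat.strong_induction_on generalizing y with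
  | _ n ih =>
    by_cases h : ∀ u, y u ∉ Set.Ioo (0 : ℝ) 1
    · exact ⟨_, DepRounding.done y h⟩
    · push Not at h
      obtain ⟨u, hu⟩ := h
      obtain ⟨v, huv, hv⟩ := exists_ne_fractional hy hk hu
      have ha₁ : min (1 - y u) (y v) ≤ 1 - y u := min_le_left _ _
      have ha₂ : min (1 - y u) (y v) ≤ y v := min_le_right _ _
      have hb₁ : min (y u) (1 - y v) ≤ y u := min_le_left _ _
      have hb₂ : min (y u) (1 - y v) ≤ 1 - y v := min_le_right _ _
      have ha₀ : 0 < min (1 - y u) (y v) := lt_min (sub_pos.2 hu.2) hv.1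
      have hb₀ : 0 < min (y u) (1 - y v) := lt_min hu.1 (sub_pos.2 hv.2)
      obtain ⟨ν₁, h₁⟩ := ih _ (hn ▸ card_fractionalCoords_shift_lt huv hu hv
          (c := min (1 - y u) (y v)) (by
            rw [shift_apply_left y huv, shift_apply_right y huv]
            rcases min_choice (1 - y u) (y v) with h | h
            · exact Or.inl fun h' => by linarith [h'.2]
            · exact Or.inr fun h' => by linarith [h'.1]))
        (shift_mem_cube hy huv ⟨by linarith [hu.1], by linarith⟩
          ⟨by linarith, by linarith [hv.2]⟩) ((sum_shift y u v _).trans hk) rfl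
      obtain ⟨ν₂, h₂⟩ := ih _ (hn ▸ card_fractionalCoords_shift_lt huv hu hv
          (c := -min (y u) (1 - y v)) (by
            rw [shift_apply_left y huv, shift_apply_right y huv]
            rcases min_choice (y u) (1 - y v) with h | h
            · exact Or.inl fun h' => by linarith [h'.1]
            · exact Or.inr fun h' => by linarith [h'.2]))
        (shift_mem_cube hy huv ⟨by linarith, by linarith [hu.2]⟩
          ⟨by linarith [hv.1], by linarith⟩) ((sum_shift y u v _).trans hk) rfl
      exact ⟨_, DepRounding.step y u v huv hu hv _ _ rfl rfl ν₁ ν₂ h₁ h₂⟩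

/-! ### The linear upper bound on the utility of feasible policies. -/

section Policies

variable {N : Type*}

/-- A lower limit along `atTop` is at most the limit of a larger sequence along a finer filter. -/
theorem liminf_le_of_tendsto {u v : ℕ → ℝ} {l : Filter ℕ} [l.NeBot] (hl : l ≤ atTop) {a : ℝ}
    (hu : IsBoundedUnder (· ≥ ·) atTop u) (huv : ∀ n, u n ≤ v n) (hv : Tendsto v l (𝓝 a)) :
    liminf u atTop ≤ a := by
  refine le_of_forall_lt fun c hc => ?_
  obtain ⟨d, hcd, hd⟩ := exists_between hc
  have h := (eventually_lt_of_lt_liminf hd hu).filter_mono hl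
  exact hcd.trans_le (ge_of_tendsto hv (h.mono fun n hn => hn.le.trans (huv n)))

theorem measurableSet_mem_coordinate (u : N) (t : ℕ) :
    MeasurableSet {S : ℕ → Finset N | u ∈ S t} :=
  (measurableSet_mem_finset u).preimage (measurable_pi_apply t)

theorem integrable_comp_coordinate [Fintype N] (g : Finset N → ℝ) (t : ℕ) (μ : Measure (ℕ → Finset N))
    [IsFiniteMeasure μ] : Integrable (fun S : ℕ → Finset N => g (S t)) μ :=
  Integrable.comp_measurable (f := fun S : ℕ → Finset N => S t) Integrable.of_finite
    (measurable_pi_apply t)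

theorem integral_sum_coordinate [Fintype N] (w : N → ℝ) (t : ℕ) (μ : Measure (ℕ → Finset N))
    [IsFiniteMeasure μ] :
    ∫ S, ∑ u ∈ S t, w u ∂μ = ∑ u, μ.real {S | u ∈ S t} * w u := by
  classical
  have h : ∀ S : ℕ → Finset N, ∑ u ∈ S t, w u =
      ∑ u, Set.indicator {S : ℕ → Finset N | u ∈ S t} (fun _ => w u) S := by
    intro S
    simp only [Set.indicator_apply, Set.mem_ofPred_eq]
    rw [← Finset.sum_filter]
    simp
  simp only [h]
  rw [integral_finsetSum _ fun u _ =>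
    (integrable_const (w u)).indicator (measurableSet_mem_coordinate u t)]
  refine Finset.sum_congr rfl fun u _ => ?_
  rw [integral_indicator_const _ (measurableSet_mem_coordinate u t), smul_eq_mul]

/-- The fraction of the first `T` rounds in which `u` is selected, in expectation. -/
noncomputable def meanSelection (μ : Measure (ℕ → Finset N)) (T : ℕ) (u : N) : ℝ :=
  (1 / (T : ℝ)) * ∑ t ∈ Finset.range T, μ.real {S | u ∈ S t}

theorem mean_le_of_forall_le {T : ℕ} {g : ℕ → ℝ} {c : ℝ} (hc : 0 ≤ c) (h : ∀ t, g t ≤ c) :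
    (1 / (T : ℝ)) * ∑ t ∈ Finset.range T, g t ≤ c := by
  have h₁ : ∑ t ∈ Finset.range T, g t ≤ T * c := by
    simpa using Finset.sum_le_card_nsmul (Finset.range T) g c fun t _ => h t
  rw [one_div, inv_mul_eq_div]
  exact div_le_of_le_mul₀ (Nat.cast_nonneg T) hc (by linarith)

theorem le_mean_of_forall_le {T : ℕ} (hT : T ≠ 0) {g : ℕ → ℝ} {c : ℝ} (h : ∀ t, c ≤ g t) :
    c ≤ (1 / (T : ℝ)) * ∑ t ∈ Finset.range T, g t := by
  have h₁ : T * c ≤ ∑ t ∈ Finset.range T, g t := by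
    simpa using Finset.card_nsmul_le_sum (Finset.range T) g c fun t _ => h t
  rw [one_div, inv_mul_eq_div, le_div_iff₀ (by positivity)]
  linarith

theorem meanSelection_mem_Icc (μ : Measure (ℕ → Finset N)) [IsProbabilityMeasure μ] (T : ℕ)
    (u : N) : meanSelection μ T u ∈ Set.Icc (0 : ℝ) 1 :=
  ⟨mul_nonneg (by positivity) (Finset.sum_nonneg fun _ _ => measureReal_nonneg),
    mean_le_of_forall_le zero_le_one fun _ => measureReal_le_one⟩

theorem sum_meanSelection_mul [Fintype N] (μ : Measure (ℕ → Finset N)) (T : ℕ) (w : N → ℝ) :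
    ∑ u, meanSelection μ T u * w u =
      (1 / (T : ℝ)) * ∑ t ∈ Finset.range T, ∑ u, μ.real {S | u ∈ S t} * w u := by
  rw [Finset.sum_comm, Finset.mul_sum]
  refine Finset.sum_congr rfl fun u _ => ?_
  rw [meanSelection, ← Finset.sum_mul, mul_assoc]

/-- The expected selection frequencies of a feasible policy accumulate at a point of the polytope,
whose linearized value at every point of the cube bounds the utility of the policy. -/
theorem IsFeasiblePolicy.exists_mem_fairPolytope [Fintype N] [DecidableEq N]
    {f : Finset N → ℝ} (hmono : Monotone f) (hsub : Submodular f) (hempty : f ∅ = 0) {r : N → ℝ} {k : ℕ} {μ : Measure (ℕ → Finset N)}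
    (hμ : IsFeasiblePolicy r k μ) :
    ∃ x ∈ fairPolytope r k, ∀ y : N → ℝ, (∀ u, y u ∈ Set.Icc (0 : ℝ) 1) →
      avgUtility f μ ≤ multilinearExt f y + ∑ u, x u * greedyWeight f y u := by
  have := hμ.isProbabilityMeasure
  have hl : (hyperfilter ℕ : Filter ℕ) ≤ atTop := Nat.hyperfilter_le_atTop
  have hf₀ : ∀ S, 0 ≤ f S := fun S => hempty ▸ hmono (Finset.empty_subset S)
  -- A limit along an ultrafilter replaces the choice of a subsequence. It is fixed before `y`, so
  -- the same `x` serves every point of the cube.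
  obtain ⟨x, hx, hlim⟩ := (isCompact_univ_pi fun _ : N => isCompact_Icc (a := (0 : ℝ))
    (b := 1)).ultrafilter_le_nhds ((hyperfilter ℕ).map (meanSelection μ))
    (le_principal_iff.2 (Filter.mem_map.2 (Eventually.of_forall fun T u _ =>
      meanSelection_mem_Icc μ T u)))
  have hx : ∀ u, x u ∈ Set.Icc (0 : ℝ) 1 := fun u => hx u (Set.mem_univ u)
  have hlim : ∀ u, Tendsto (fun T => meanSelection μ T u) (hyperfilter ℕ) (𝓝 (x u)) :=
    tendsto_pi_nhds.1 hlim
  refine ⟨x, ⟨fun u => ?_, hx, ?_⟩, fun y hy => ?_⟩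
  · exact (hμ.fair u).trans (liminf_le_of_tendsto hl
      (isBoundedUnder_of ⟨0, fun T => (meanSelection_mem_Icc μ T u).1⟩) (fun _ => le_rfl)
      (hlim u))
  · refine le_of_tendsto (tendsto_finsetSum _ fun u _ => hlim u) (Eventually.of_forall fun T => ?_)
    have h₁ := sum_meanSelection_mul μ T 1
    simp only [Pi.one_apply, mul_one] at h₁
    rw [h₁]
    refine mean_le_of_forall_le (Nat.cast_nonneg k) fun t => ?_
    have h₂ := integral_sum_coordinate 1 t μ
    simp only [Pi.one_apply, mul_one] at h₂
    rw [← h₂]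
    have h₃ : ∫ S : ℕ → Finset N, (∑ u ∈ S t, (1 : ℝ)) ∂μ ≤ ∫ _ : ℕ → Finset N, (k : ℝ) ∂μ := by
      refine integral_mono_ae
        (integrable_comp_coordinate (fun A => ∑ u ∈ A, (1 : ℝ)) t μ) (integrable_const _) ?_
      filter_upwards [hμ.card_le] with S hS
      simpa using hS t
    simpa using h₃
  · have hround : ∀ t, ∫ S, f (S t) ∂μ ≤
        multilinearExt f y + ∑ u, μ.real {S | u ∈ S t} * greedyWeight f y u := by
      intro t
      rw [← integral_sum_coordinate]
      have h := integral_mono (integrable_comp_coordinate f t μ)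
        ((integrable_const (multilinearExt f y)).add
          (integrable_comp_coordinate (fun A => ∑ u ∈ A, greedyWeight f y u) t μ))
        (fun S => by
          simpa only [Pi.add_apply, greedyWeight_eq_expectedGain f hy] using
            le_multilinearExt_add_sum_expectedGain hmono hsub hy (S t))
      simp only [Pi.add_apply] at h
      rw [integral_add (integrable_const _)
        (integrable_comp_coordinate (fun A => ∑ u ∈ A, greedyWeight f y u) t μ)] at h
      simpa using h
    -- Needed at T = 0, where 1 / 0 = 0 makes the mean of the constant F(y) equal to 0.
    have hF : 0 ≤ multilinearExt f y := by
      simpa [multilinearExt_const] using multilinearExt_mono hf₀ hy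
    refine liminf_le_of_tendsto hl (isBoundedUnder_of ⟨0, fun T => ?_⟩)
      (v := fun T => multilinearExt f y + ∑ u, meanSelection μ T u * greedyWeight f y u)
      (fun T => ?_)
      (tendsto_const_nhds.add (tendsto_finsetSum _ fun u _ => (hlim u).mul_const _))
    · exact mul_nonneg (by positivity)
        (Finset.sum_nonneg fun t _ => integral_nonneg fun S => hf₀ (S t))
    · rw [sum_meanSelection_mul, ← sub_le_iff_le_add]
      have h₁ : (1 / (T : ℝ)) * ∑ t ∈ Finset.range T, ∫ S, f (S t) ∂μ ≤
          (1 / (T : ℝ)) * ∑ t ∈ Finset.range T, multilinearExt f y +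
          (1 / (T : ℝ)) * ∑ t ∈ Finset.range T,
            ∑ u, μ.real {S | u ∈ S t} * greedyWeight f y u := by
        rw [← mul_add, ← Finset.sum_add_distrib]
        exact mul_le_mul_of_nonneg_left (Finset.sum_le_sum fun t _ => hround t) (by positivity)
      have h₂ := mean_le_of_forall_le (T := T) (g := fun _ => multilinearExt f y) hF
        fun _ => le_rfl
      linarith

end Policies

/-! ### Differential equations with discontinuous right-hand side. -/

section Krasovskii

variable {E : Type*} [NormedAddCommGroup E] [NormedSpace ℝ E]

/-- The explicit Euler scheme with step `h` for the autonomous equation `y' = σ y`, started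
at `0`. -/
def eulerSeq (σ : E → E) (h : ℝ) : ℕ → E
  | 0 => 0
  | j + 1 => eulerSeq σ h j + h • σ (eulerSeq σ h j)

theorem eulerSeq_add_sub (σ : E → E) (h : ℝ) (i n : ℕ) :
    eulerSeq σ h (i + n) - eulerSeq σ h i =
      h • ∑ j ∈ Finset.range n, σ (eulerSeq σ h (i + j)) := by
  induction n with
  | zero => simp
  | succ n ih =>
    rw [Finset.sum_range_succ, smul_add, ← ih, ← add_assoc, eulerSeq]
    abel

theorem norm_eulerSeq_add_sub_le {σ : E → E} {C : ℝ} (hσ : ∀ p, ‖σ p‖ ≤ C) {h : ℝ} (hh : 0 ≤ h)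
    (i n : ℕ) : ‖eulerSeq σ h (i + n) - eulerSeq σ h i‖ ≤ C * (n * h) := by
  rw [eulerSeq_add_sub, norm_smul, Real.norm_of_nonneg hh]
  have h₁ : ‖∑ j ∈ Finset.range n, σ (eulerSeq σ h (i + j))‖ ≤ ∑ j ∈ Finset.range n, C :=
    norm_sum_le_of_le _ fun j _ => hσ _
  rw [Finset.sum_const, Finset.card_range, nsmul_eq_mul] at h₁
  calc h * _ ≤ h * (n * C) := mul_le_mul_of_nonneg_left h₁ hh
    _ = C * (n * h) := by ring

theorem tendsto_floor_mul_succ_div {t : ℝ} (ht : 0 ≤ t) :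
    Tendsto (fun m : ℕ => (⌊t * (m + 1 : ℝ)⌋₊ : ℝ) * (m + 1 : ℝ)⁻¹) atTop (𝓝 t) := by
  have h : Tendsto (fun m : ℕ => (m + 1 : ℝ)) atTop atTop :=
    tendsto_natCast_atTop_atTop.atTop_add tendsto_const_nhds
  simpa only [Function.comp_def, div_eq_mul_inv] using
    (tendsto_nat_floor_mul_div_atTop (R := ℝ) ht).comp h

/-- A discontinuous autonomous differential equation with bounded right-hand side has a
Lipschitz solution in the sense of Krasovskii: the right difference quotients at `τ` eventually lie
in every closed convex set that contains the values of the right-hand side near `y τ`. -/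
theorem exists_krasovskii_path [FiniteDimensional ℝ E] (σ : E → E) (C : NNReal)
    (hσ : ∀ p, ‖σ p‖ ≤ C) :
    ∃ y : ℝ → E, LipschitzOnWith C y (Set.Ici 0) ∧ y 0 = 0 ∧
      ∀ τ, 0 ≤ τ → ∀ H : Set E, IsClosed H → Convex ℝ H → (∀ᶠ p in 𝓝 (y τ), σ p ∈ H) →
        ∀ᶠ t in 𝓝[>] τ, (t - τ)⁻¹ • (y t - y τ) ∈ H := by
  -- The `m`-th scheme has step 1 / (m + 1), and `n t m` counts its steps up to time `t`.
  set h : ℕ → ℝ := fun m => (m + 1 : ℝ)⁻¹ with hdef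
  have hpos : ∀ m, 0 < h m := fun m => by positivity
  set n : ℝ → ℕ → ℕ := fun t m => ⌊t * (m + 1 : ℝ)⌋₊ with ndef
  have hn : ∀ t, 0 ≤ t → Tendsto (fun m => (n t m : ℝ) * h m) (hyperfilter ℕ) (𝓝 t) := fun t ht =>
    (tendsto_floor_mul_succ_div ht).mono_left Nat.hyperfilter_le_atTop
  have nmono : ∀ s t m, s ≤ t → n s m ≤ n t m := fun s t m hst =>
    Nat.floor_mono (mul_le_mul_of_nonneg_right hst (by positivity))
  set Y : ℕ → ℝ → E := fun m t => eulerSeq σ (h m) (n t m) with Ydef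
  have Ybound : ∀ m s t, s ≤ t → ‖Y m t - Y m s‖ ≤ C * ((n t m : ℝ) * h m - n s m * h m) := by
    intro m s t hst
    obtain ⟨d, hd⟩ := Nat.exists_eq_add_of_le (nmono s t m hst)
    have := norm_eulerSeq_add_sub_le hσ (hpos m).le (n s m) d
    rw [← hd] at this
    refine this.trans_eq ?_
    rw [hd]
    push_cast
    ring
  have Yzero : ∀ m, Y m 0 = 0 := fun m => by simp [Ydef, ndef, eulerSeq]
  -- The ultrafilter gives pointwise limits at all times at once, without an Arzelà–Ascoli argument.
  have hlim : ∀ t, 0 ≤ t → ∃ p, Tendsto (fun m => Y m t) (hyperfilter ℕ) (𝓝 p) := by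
    intro t ht
    have hb : ∀ m, Y m t ∈ Metric.closedBall (0 : E) (C * t) := by
      intro m
      rw [mem_closedBall_zero_iff]
      have h₁ := Ybound m 0 t ht
      rw [Yzero, sub_zero] at h₁
      refine h₁.trans (mul_le_mul_of_nonneg_left ?_ C.2)
      have h₂ : (n t m : ℝ) ≤ t * (m + 1 : ℝ) := Nat.floor_le (by positivity)
      have h₃ : (n t m : ℝ) * h m ≤ t := by
        rw [hdef]
        exact (mul_inv_le_iff₀ (by positivity)).2 h₂
      have h₄ : (0 : ℝ) ≤ n 0 m * h m := mul_nonneg (Nat.cast_nonneg _) (hpos m).le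
      linarith
    obtain ⟨p, -, hp⟩ := (isCompact_closedBall (0 : E) (C * t)).ultrafilter_le_nhds
      ((hyperfilter ℕ).map fun m => Y m t)
      (le_principal_iff.2 (Filter.mem_map.2 (Filter.Eventually.of_forall hb)))
    exact ⟨p, hp⟩
  choose! y hy using hlim
  have ybound : ∀ s t, 0 ≤ s → s ≤ t → ‖y t - y s‖ ≤ C * (t - s) := fun s t hs hst =>
    le_of_tendsto_of_tendsto ((hy t (hs.trans hst)).sub (hy s hs)).norm
      (((hn t (hs.trans hst)).sub (hn s hs)).const_mul _)
      (Eventually.of_forall fun m => Ybound m s t hst)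
  refine ⟨y, ?_, ?_, ?_⟩
  · refine LipschitzOnWith.of_dist_le_mul fun s hs t ht => ?_
    rw [dist_eq_norm, Real.dist_eq]
    rcases le_total s t with hst | hst
    · rw [norm_sub_rev, abs_sub_comm, abs_of_nonneg (sub_nonneg.2 hst)]
      exact ybound s t hs hst
    · rw [abs_of_nonneg (sub_nonneg.2 hst)]
      exact ybound t s ht hst
  · have h₀ := hy 0 le_rfl
    simp only [Yzero] at h₀
    exact tendsto_nhds_unique h₀ tendsto_const_nhds
  · intro τ hτ H hclosed hconv hH
    obtain ⟨δ, hδ, hball⟩ := Metric.eventually_nhds_iff.1 hH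
    -- Half of δ is for the drift of the scheme between `τ` and `t`, the other half for the distance
    -- from `Y m τ` to `y τ`.
    have hnear : ∀ᶠ t in 𝓝[>] τ, C * (t - τ) < δ / 2 := by
      have : Tendsto (fun t : ℝ => C * (t - τ)) (𝓝 τ) (𝓝 (C * (τ - τ))) :=
        (Continuous.tendsto (by fun_prop) τ)
      rw [sub_self, mul_zero] at this
      exact (this.mono_left nhdsWithin_le_nhds).eventually (gt_mem_nhds (half_pos hδ))
    filter_upwards [hnear, self_mem_nhdsWithin] with t ht hτt
    have hτt : τ < t := hτt
    have ht₀ : 0 ≤ t := hτ.trans hτt.le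
    have hdiff : Tendsto (fun m => (n t m : ℝ) * h m - n τ m * h m) (hyperfilter ℕ)
        (𝓝 (t - τ)) := (hn t ht₀).sub (hn τ hτ)
    have hslope : Tendsto (fun m => ((n t m : ℝ) * h m - n τ m * h m)⁻¹ • (Y m t - Y m τ))
        (hyperfilter ℕ) (𝓝 ((t - τ)⁻¹ • (y t - y τ))) :=
      (hdiff.inv₀ (sub_pos.2 hτt).ne').smul ((hy t ht₀).sub (hy τ hτ))
    refine hclosed.mem_of_tendsto hslope ?_
    filter_upwards [(hdiff.const_mul (C : ℝ)).eventually (gt_mem_nhds ht),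
      hdiff.eventually (lt_mem_nhds (sub_pos.2 hτt)),
      (hy τ hτ).eventually (Metric.ball_mem_nhds _ (half_pos hδ))] with m hm₁ hm₂ hm₃
    obtain ⟨d, hd⟩ := Nat.exists_eq_add_of_le (nmono τ t m hτt.le)
    have hd' : (n t m : ℝ) * h m - n τ m * h m = d * h m := by
      rw [hd]
      push_cast
      ring
    rw [hd'] at hm₁ hm₂ ⊢
    have hd₀ : (0 : ℝ) < d := pos_of_mul_pos_left hm₂ (hpos m).le
    have hval : ∀ j ∈ Finset.range d, σ (eulerSeq σ (h m) (n τ m + j)) ∈ H := by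
      intro j hj
      refine hball ?_
      have hj' : (j : ℝ) ≤ d := by exact_mod_cast (Finset.mem_range.1 hj).le
      have h₁ : dist (eulerSeq σ (h m) (n τ m + j)) (Y m τ) ≤ C * (d * h m) := by
        rw [dist_eq_norm]
        refine (norm_eulerSeq_add_sub_le hσ (hpos m).le (n τ m) j).trans ?_
        exact mul_le_mul_of_nonneg_left (mul_le_mul_of_nonneg_right hj' (hpos m).le) C.2
      have h₂ : dist (Y m τ) (y τ) < δ / 2 := hm₃
      linarith [dist_triangle (eulerSeq σ (h m) (n τ m + j)) (Y m τ) (y τ)]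
    have hYd : Y m t - Y m τ =
        h m • ∑ j ∈ Finset.range d, σ (eulerSeq σ (h m) (n τ m + j)) := by
      rw [← eulerSeq_add_sub, ← hd]
    -- The difference quotient of the scheme is the average of `d` values of `σ` in `H`, each with
    -- weight 1 / d.
    rw [hYd, smul_smul, mul_inv, mul_assoc, inv_mul_cancel₀ (hpos m).ne', mul_one,
      Finset.smul_sum]
    refine hconv.sum_mem (fun _ _ => by positivity) ?_ hval
    rw [Finset.sum_const, Finset.card_range, nsmul_eq_mul, mul_inv_cancel₀ hd₀.ne']

end Krasovskii

/-! ### Paths as integrals of their derivatives. -/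

section PolytopePaths

variable {N : Type*} [Fintype N]

theorem intervalIntegral_apply {x : ℝ → N → ℝ} {a b : ℝ} (hx : IntervalIntegrable x volume a b)
    (u : N) : (∫ s in a..b, x s) u = ∫ s in a..b, x s u :=
  ((ContinuousLinearMap.proj (R := ℝ) (φ := fun _ : N => ℝ) u).intervalIntegral_comp_comm hx).symm

theorem intervalIntegrable_apply {x : ℝ → N → ℝ} {a b : ℝ}
    (hx : IntervalIntegrable x volume a b) (u : N) :
    IntervalIntegrable (fun s => x s u) volume a b :=
  ⟨hx.1.eval u, hx.2.eval u⟩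

theorem intervalIntegral_mem_cube {x : ℝ → N → ℝ} (hx : IntervalIntegrable x volume 0 1)
    (hmem : ∀ᵐ s, s ∈ Set.Icc (0 : ℝ) 1 → ∀ u, x s u ∈ Set.Icc (0 : ℝ) 1) {τ : ℝ}
    (hτ : τ ∈ Set.Icc (0 : ℝ) 1) (u : N) : (∫ s in (0 : ℝ)..τ, x s) u ∈ Set.Icc (0 : ℝ) 1 := by
  have hxτ : IntervalIntegrable x volume 0 τ :=
    hx.mono_set (Set.uIcc_subset_uIcc_left (by rwa [Set.uIcc_of_le zero_le_one]))
  have hmem' : ∀ᵐ s ∂volume.restrict (Set.Icc 0 τ), x s u ∈ Set.Icc (0 : ℝ) 1 := by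
    rw [ae_restrict_iff' measurableSet_Icc]
    filter_upwards [hmem] with s hs hsτ
    exact hs ⟨hsτ.1, hsτ.2.trans hτ.2⟩ u
  rw [intervalIntegral_apply hxτ]
  refine ⟨intervalIntegral.integral_nonneg_of_ae_restrict hτ.1 (hmem'.mono fun s hs => hs.1), ?_⟩
  have h := intervalIntegral.integral_mono_ae_restrict hτ.1 (intervalIntegrable_apply hxτ u)
    (intervalIntegrable_const (c := (1 : ℝ))) (hmem'.mono fun s hs => hs.2)
  have h₁ : ∫ _ in (0 : ℝ)..τ, (1 : ℝ) = τ := by simp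
  exact (h.trans_eq h₁).trans hτ.2

/-- The integrand has sup norm at most 1. This makes F along the path absolutely continuous, so that
it can be recovered from its derivative. -/
theorem lipschitzOnWith_intervalIntegral {x : ℝ → N → ℝ} (hx : IntervalIntegrable x volume 0 1)
    (hmem : ∀ᵐ s, s ∈ Set.Icc (0 : ℝ) 1 → ∀ u, x s u ∈ Set.Icc (0 : ℝ) 1) :
    LipschitzOnWith 1 (fun τ => ∫ s in (0 : ℝ)..τ, x s) (Set.Icc 0 1) := by
  refine LipschitzOnWith.of_dist_le_mul fun a ha b hb => ?_
  have hsub : ∀ c ∈ Set.Icc (0 : ℝ) 1, IntervalIntegrable x volume 0 c := fun c hc =>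
    hx.mono_set (Set.uIcc_subset_uIcc_left (by rwa [Set.uIcc_of_le zero_le_one]))
  rw [dist_eq_norm, intervalIntegral.integral_interval_sub_left (hsub a ha) (hsub b hb),
    Real.dist_eq]
  refine intervalIntegral.norm_integral_le_of_norm_le_const_ae ?_
  filter_upwards [hmem] with s hs hsab
  have hs' : s ∈ Set.Icc (0 : ℝ) 1 :=
    (Set.uIoc_subset_uIcc.trans (Set.ordConnected_Icc.uIcc_subset hb ha)) hsab
  refine (pi_norm_le_iff_of_nonneg zero_le_one).2 fun u => ?_
  rw [Real.norm_of_nonneg (hs hs' u).1]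
  exact (hs hs' u).2

theorem sum_intervalIntegral {x : ℝ → N → ℝ} (hx : IntervalIntegrable x volume 0 1) {c : ℝ}
    (hmem : ∀ᵐ s, s ∈ Set.Icc (0 : ℝ) 1 → ∑ u, x s u = c) :
    ∑ u, (∫ s in (0 : ℝ)..1, x s) u = c := by
  simp only [intervalIntegral_apply hx]
  rw [← intervalIntegral.integral_finsetSum fun u _ => intervalIntegrable_apply hx u]
  have h : ∫ s in (0 : ℝ)..1, ∑ u, x s u = ∫ _ in (0 : ℝ)..1, c := by
    refine intervalIntegral.integral_congr_ae ?_
    filter_upwards [hmem] with s hs hs₁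
    rw [Set.uIoc_of_le zero_le_one] at hs₁
    exact hs ⟨hs₁.1.le, hs₁.2⟩
  simpa using h

/-- A Lipschitz curve in a finite product is the integral of its coordinatewise derivative. -/
theorem exists_intervalIntegral_of_lipschitzOnWith {y : ℝ → N → ℝ} {C : NNReal}
    (hy : LipschitzOnWith C y (Set.Icc 0 1)) (hy₀ : y 0 = 0) :
    ∃ x : ℝ → N → ℝ, IntervalIntegrable x volume 0 1 ∧
      (∀ᵐ τ, τ ∈ Set.Icc (0 : ℝ) 1 → HasDerivAt y (x τ) τ) ∧
      ∀ τ ∈ Set.Icc (0 : ℝ) 1, y τ = ∫ s in (0 : ℝ)..τ, x s := by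
  have hlip : ∀ u, LipschitzOnWith C (fun τ => y τ u) (Set.uIcc 0 1) := by
    intro u
    rw [Set.uIcc_of_le zero_le_one]
    have := (LipschitzWith.eval (α := fun _ : N => ℝ) u).comp_lipschitzOnWith hy
    rwa [one_mul] at this
  have hac := fun u => (hlip u).absolutelyContinuousOnInterval
  have hint : IntervalIntegrable (fun τ u => deriv (fun s => y s u) τ) volume 0 1 :=
    ⟨Integrable.of_eval fun u => (hac u).intervalIntegrable_deriv.1,
      Integrable.of_eval fun u => (hac u).intervalIntegrable_deriv.2⟩
  refine ⟨fun τ u => deriv (fun s => y s u) τ, hint, ?_, fun τ hτ => ?_⟩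
  · filter_upwards [ae_all_iff.2 fun u => (hac u).ae_differentiableAt] with τ hd hτ
    refine hasDerivAt_pi.2 fun u => (hd u ?_).hasDerivAt
    rwa [Set.uIcc_of_le zero_le_one]
  · have hsub : Set.uIcc 0 τ ⊆ Set.uIcc (0 : ℝ) 1 :=
      Set.uIcc_subset_uIcc_left (by rwa [Set.uIcc_of_le zero_le_one])
    ext u
    rw [intervalIntegral_apply (hint.mono_set hsub), ((hac u).mono hsub).integral_deriv_eq_sub,
      hy₀, Pi.zero_apply, sub_zero]

end PolytopePaths

/-! ### The differential inequality behind 1 - 1/e. -/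

section GreedyBound

variable {N : Type*} [Fintype N] [DecidableEq N] {f : Finset N → ℝ} {r : N → ℝ} {k : ℕ}
  {y : ℝ → N → ℝ}

theorem IsGreedyPath.mem_cube (hy : IsGreedyPath f r k y) {τ : ℝ} (hτ : τ ∈ Set.Icc (0 : ℝ) 1)
    (u : N) : y τ u ∈ Set.Icc (0 : ℝ) 1 := by
  obtain ⟨x, hx, hdir, hint⟩ := hy
  rw [ae_restrict_iff' measurableSet_Icc] at hdir
  rw [hint τ hτ]
  exact intervalIntegral_mem_cube hx
    (hdir.mono fun s hs hs' => (hs hs').mem.2.1) hτ u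

theorem IsGreedyPath.sum_one (hy : IsGreedyPath f r k y) : ∑ u, y 1 u = k := by
  obtain ⟨x, hx, hdir, hint⟩ := hy
  rw [ae_restrict_iff' measurableSet_Icc] at hdir
  rw [hint 1 ⟨zero_le_one, le_rfl⟩]
  exact sum_intervalIntegral hx (hdir.mono fun s hs hs' => (hs hs').sum_eq)

/-- The continuous greedy process reaches the fraction `1 - 1 / e` of every number which the
linearization of `f` over the polytope dominates at every point of the cube. -/
theorem IsGreedyPath.le_multilinearExt (hmono : Monotone f) (hempty : f ∅ = 0)
    (hy : IsGreedyPath f r k y) {U : ℝ}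
    (hU : ∃ x ∈ fairPolytope r k, ∀ p : N → ℝ, (∀ u, p u ∈ Set.Icc (0 : ℝ) 1) →
      U ≤ multilinearExt f p + ∑ u, x u * greedyWeight f p u) :
    (1 - 1 / Real.exp 1) * U ≤ multilinearExt f (y 1) := by
  have hcube := fun {τ : ℝ} (hτ : τ ∈ Set.Icc (0 : ℝ) 1) => hy.mem_cube hτ
  obtain ⟨x, hx, hdir, hint⟩ := hy
  obtain ⟨z, hz, hzU⟩ := hU
  rw [ae_restrict_iff' measurableSet_Icc] at hdir
  have hmem : ∀ᵐ s, s ∈ Set.Icc (0 : ℝ) 1 → ∀ u, x s u ∈ Set.Icc (0 : ℝ) 1 :=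
    hdir.mono fun s hs hs' => (hs hs').mem.2.1
  -- `y` is constrained only on [0,1]; the primitive `Y` agrees with it there and is defined
  -- everywhere.
  set Y : ℝ → N → ℝ := fun τ => ∫ s in (0 : ℝ)..τ, x s with hY
  have hYcube : ∀ τ ∈ Set.Icc (0 : ℝ) 1, Y τ ∈ Set.Icc (0 : N → ℝ) 1 := fun τ hτ => by
    have hYτ : Y τ = y τ := (hint τ hτ).symm
    rw [hYτ]
    exact ⟨fun u => (hcube hτ u).1, fun u => (hcube hτ u).2⟩
  obtain ⟨K, hK⟩ := (contDiff_multilinearExt f).contDiffOn.exists_lipschitzOnWith one_ne_zero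
    (convex_Icc (0 : N → ℝ) 1) isCompact_Icc
  have hFY : AbsolutelyContinuousOnInterval (fun τ => multilinearExt f (Y τ)) 0 1 := by
    refine LipschitzOnWith.absolutelyContinuousOnInterval (K := K * 1) ?_
    rw [Set.uIcc_of_le zero_le_one]
    exact hK.comp (lipschitzOnWith_intervalIntegral hx hmem) hYcube
  have hexp : AbsolutelyContinuousOnInterval Real.exp 0 1 :=
    Real.contDiff_exp.contDiffOn.absolutelyContinuousOnInterval
  have hFU : AbsolutelyContinuousOnInterval (fun τ => multilinearExt f (Y τ) - U) 0 1 :=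
    hFY.fun_sub (LipschitzWith.const U).lipschitzOnWith.absolutelyContinuousOnInterval
  -- With the integrating factor e^τ the derivative is e^τ (F - U + F'), and F' ≥ U - F makes it
  -- nonnegative.
  have hφ := (hexp.fun_mul hFU).integral_deriv_eq_sub
  have hnonneg : 0 ≤ ∫ τ in (0 : ℝ)..1,
      deriv (fun τ => Real.exp τ * (multilinearExt f (Y τ) - U)) τ := by
    refine intervalIntegral.integral_nonneg_of_ae_restrict zero_le_one ?_
    refine (ae_restrict_iff' measurableSet_Icc).2 ?_
    filter_upwards [hdir, hx.ae_hasDerivAt_integral] with τ hτdir hτderiv hτ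
    have hYd : HasDerivAt Y (x τ) τ := by
      rw [Set.uIcc_of_le zero_le_one] at hτderiv
      exact hτderiv hτ 0 ⟨le_rfl, zero_le_one⟩
    have hFd : HasDerivAt (fun τ => multilinearExt f (Y τ))
        (fderiv ℝ (multilinearExt f) (Y τ) (x τ)) τ :=
      ((contDiff_multilinearExt f).differentiable one_ne_zero (Y τ)).hasFDerivAt.comp_hasDerivAt
        τ hYd
    have hd := (Real.hasDerivAt_exp τ).mul (hFd.sub_const U)
    have hd' : deriv (fun τ => Real.exp τ * (multilinearExt f (Y τ) - U)) τ = _ := hd.deriv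
    rw [hd', Pi.zero_apply, ← mul_add]
    refine mul_nonneg (Real.exp_pos τ).le ?_
    have hYτ : Y τ = y τ := (hint τ hτ).symm
    rw [hYτ]
    have h₁ := sum_mul_expectedGain_le_fderiv hmono (hcube hτ) fun u =>
      ((hτdir hτ).mem.2.1 u).1
    have h₂ := (hτdir hτ).isMaxOn hz
    have h₃ := hzU (y τ) (hcube hτ)
    simp only [Set.mem_ofPred_eq, greedyWeight_eq_expectedGain f (hcube hτ)] at h₂ h₃
    linarith
  have hY₀ : multilinearExt f (Y 0) = 0 := by
    have h := multilinearExt_indicator f ∅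
    simp only [Finset.notMem_empty, if_false, hempty] at h
    have hz₀ : Y 0 = fun _ => 0 := by
      rw [hY]
      exact intervalIntegral.integral_same
    rwa [hz₀]
  have hY₁ : Y 1 = y 1 := (hint 1 ⟨zero_le_one, le_rfl⟩).symm
  rw [hφ, hY₀, hY₁, Real.exp_zero] at hnonneg
  have he := Real.exp_pos 1
  rw [one_sub_div he.ne', div_mul_eq_mul_div, div_le_iff₀ he]
  linarith

end GreedyBound

/-! ### Existence of greedy paths. -/

section GreedyExistence

variable {N : Type*} [Fintype N] {r : N → ℝ} {k : ℕ}

/-- The face of the polytope on which the budget is exhausted. -/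
def budgetFace (r : N → ℝ) (k : ℕ) : Set (N → ℝ) :=
  {x | x ∈ fairPolytope r k ∧ ∑ u, x u = k}

/-- Moving `z` towards the all-ones vector raises the sum continuously up to n ≥ k; `c` is the
fraction at which it equals k. -/
theorem exists_budgetFace_ge (hkn : k ≤ Fintype.card N) {z : N → ℝ} (hz : z ∈ fairPolytope r k) :
    ∃ x ∈ budgetFace r k, ∀ u, z u ≤ x u := by
  obtain ⟨hr, hcube, hsum⟩ := hz
  have hkn' : (k : ℝ) ≤ Fintype.card N := by exact_mod_cast hkn
  rcases hsum.eq_or_lt with h | h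
  · exact ⟨z, ⟨⟨hr, hcube, hsum⟩, h⟩, fun u => le_rfl⟩
  · have hpos : 0 < Fintype.card N - ∑ u, z u := by linarith
    set c : ℝ := (k - ∑ u, z u) / (Fintype.card N - ∑ u, z u) with hc
    have hc₀ : 0 ≤ c := div_nonneg (by linarith) hpos.le
    have hc₁ : c ≤ 1 := (div_le_one hpos).2 (by linarith)
    have hle : ∀ u, z u ≤ z u + c * (1 - z u) := fun u =>
      le_add_of_nonneg_right (mul_nonneg hc₀ (sub_nonneg.2 (hcube u).2))
    have htot : ∑ u, (z u + c * (1 - z u)) = k := by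
      rw [Finset.sum_add_distrib, ← Finset.mul_sum, Finset.sum_sub_distrib]
      simp only [Finset.sum_const, Finset.card_univ, nsmul_eq_mul, mul_one]
      rw [hc, div_mul_cancel₀ _ hpos.ne']
      ring
    refine ⟨fun u => z u + c * (1 - z u), ⟨⟨fun u => (hr u).trans (hle u), fun u =>
      ⟨(hcube u).1.trans (hle u), ?_⟩, htot.le⟩, htot⟩, hle⟩
    nlinarith [(hcube u).2]

theorem isClosed_budgetFace : IsClosed (budgetFace r k) := by
  have h : budgetFace r k = Set.Icc r 1 ∩ Set.Icc 0 1 ∩ {x | ∑ u, x u = k} := by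
    ext x
    simp only [budgetFace, fairPolytope, Set.mem_ofPred_eq, Set.mem_inter_iff, Set.mem_Icc,
      Pi.le_def, Pi.zero_apply, Pi.one_apply]
    constructor
    · rintro ⟨⟨h₁, h₂, -⟩, h₃⟩
      exact ⟨⟨⟨h₁, fun u => (h₂ u).2⟩, fun u => (h₂ u).1, fun u => (h₂ u).2⟩, h₃⟩
    · rintro ⟨⟨⟨h₁, -⟩, h₂, h₃⟩, h₄⟩
      exact ⟨⟨h₁, fun u => ⟨h₂ u, h₃ u⟩, h₄.le⟩, h₄⟩
  rw [h]
  exact (isClosed_Icc.inter isClosed_Icc).inter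
    (isClosed_eq (continuous_finsetSum _ fun u _ => continuous_apply u) continuous_const)

theorem isCompact_budgetFace : IsCompact (budgetFace r k) :=
  (isCompact_Icc (a := (0 : N → ℝ)) (b := 1)).of_isClosed_subset isClosed_budgetFace
    fun _ hx => ⟨fun u => (hx.1.2.1 u).1, fun u => (hx.1.2.1 u).2⟩

theorem convex_budgetFace : Convex ℝ (budgetFace r k) := by
  rintro x ⟨⟨hx₁, hx₂, -⟩, hx₄⟩ z ⟨⟨hz₁, hz₂, -⟩, hz₄⟩ a b ha hb hab
  have htot : ∑ u, (a • x + b • z) u = k := by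
    simp only [Pi.add_apply, Pi.smul_apply, smul_eq_mul, Finset.sum_add_distrib,
      ← Finset.mul_sum, hx₄, hz₄]
    rw [← add_mul, hab, one_mul]
  refine ⟨⟨fun u => ?_, fun u => convex_Icc 0 1 (hx₂ u) (hz₂ u) ha hb hab, htot.le⟩, htot⟩
  exact convex_Ici (r u) (hx₁ u) (hz₁ u) ha hb hab

theorem exists_isMaxOn_budgetFace (h : (budgetFace r k).Nonempty) (w : N → ℝ) :
    ∃ x ∈ budgetFace r k, ∀ z ∈ budgetFace r k, ∑ u, z u * w u ≤ ∑ u, x u * w u := by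
  obtain ⟨x, hx, hmax⟩ := isCompact_budgetFace.exists_isMaxOn h
    (f := fun z : N → ℝ => ∑ u, z u * w u)
    (continuous_finsetSum _ fun u _ => (continuous_apply u).mul continuous_const).continuousOn
  exact ⟨x, hx, fun z hz => hmax hz⟩

variable [DecidableEq N] {f : Finset N → ℝ}

/-- The weights are nonnegative, so raising a point to the budget face does not lower the objective.
-/
theorem isGreedyDirection_of_budgetFace (hmono : Monotone f) (hkn : k ≤ Fintype.card N)
    {p x : N → ℝ} (hp : ∀ u, p u ∈ Set.Icc (0 : ℝ) 1) (hx : x ∈ budgetFace r k)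
    (hmax : ∀ z ∈ budgetFace r k,
      ∑ u, z u * expectedGain f p u ≤ ∑ u, x u * expectedGain f p u) :
    IsGreedyDirection f r k p x := by
  refine ⟨hx.1, fun z hz => ?_, hx.2⟩
  obtain ⟨z', hz', hle⟩ := exists_budgetFace_ge hkn hz
  simp only [Set.mem_ofPred_eq, greedyWeight_eq_expectedGain f hp]
  exact (Finset.sum_le_sum fun u _ =>
    mul_le_mul_of_nonneg_right (hle u) (expectedGain_nonneg hmono hp u)).trans (hmax z' hz')

theorem exists_isGreedyPath (hmono : Monotone f) (hkn : k ≤ Fintype.card N)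
    (hne : (fairPolytope r k).Nonempty) : ∃ y, IsGreedyPath f r k y := by
  obtain ⟨z₀, hz₀⟩ := hne
  obtain ⟨x₀, hx₀, -⟩ := exists_budgetFace_ge hkn hz₀
  -- The selection is made at every point of the space, not only in the cube, as the path theorem
  -- requires.
  choose σ hσmem hσmax using fun p => exists_isMaxOn_budgetFace ⟨x₀, hx₀⟩ (expectedGain f p)
  have hσcube : ∀ p u, σ p u ∈ Set.Icc (0 : ℝ) 1 := fun p u => (hσmem p).1.2.1 u
  obtain ⟨y, hlip, hy₀, hslope⟩ := exists_krasovskii_path σ 1 fun p =>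
    (pi_norm_le_iff_of_nonneg zero_le_one).2 fun u => by
      rw [Real.norm_of_nonneg (hσcube p u).1]
      exact (hσcube p u).2
  have hderiv : ∀ τ, 0 ≤ τ → ∀ d, HasDerivAt y d τ → ∀ H : Set (N → ℝ), IsClosed H →
      Convex ℝ H → (∀ᶠ p in 𝓝 (y τ), σ p ∈ H) → d ∈ H := by
    intro τ hτ d hd H hclosed hconv hH
    have ht := (hasDerivWithinAt_iff_tendsto_slope' Set.self_notMem_Ioi).1
      (hd.hasDerivWithinAt (s := Set.Ioi τ))
    refine hclosed.mem_of_tendsto ht ?_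
    filter_upwards [hslope τ hτ H hclosed hconv hH] with t ht
    simpa [slope_def_module] using ht
  obtain ⟨x, hx, hxd, hint⟩ :=
    exists_intervalIntegral_of_lipschitzOnWith (hlip.mono Set.Icc_subset_Ici_self) hy₀
  have hface : ∀ᵐ τ, τ ∈ Set.Icc (0 : ℝ) 1 → x τ ∈ budgetFace r k := hxd.mono fun τ hτ hτ' =>
    hderiv τ hτ'.1 _ (hτ hτ') _ isClosed_budgetFace convex_budgetFace
      (Eventually.of_forall hσmem)
  refine ⟨y, x, hx, ?_, hint⟩
  rw [ae_restrict_iff' measurableSet_Icc]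
  filter_upwards [hxd, hface] with τ hτd hτface hτ
  have hcube : ∀ u, y τ u ∈ Set.Icc (0 : ℝ) 1 := fun u => by
    rw [hint τ hτ]
    exact intervalIntegral_mem_cube hx (hface.mono fun s hs hs' => (hs hs').1.2.1) hτ u
  refine isGreedyDirection_of_budgetFace hmono hkn hcube (hτface hτ) fun z hz => ?_
  -- Near `y τ` the weights change little, so `σ p` is ε-optimal for the weights at `y τ`. The
  -- ε-optimality condition is a closed half-space, hence the derivative inherits it.
  refine le_of_forall_pos_sub_le fun ε hε => ?_
  set w := expectedGain f (y τ) with hw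
  have hlin : Continuous fun a : N → ℝ => ∑ u, a u * w u :=
    continuous_finsetSum _ fun u _ => (continuous_apply u).mul continuous_const
  refine hderiv τ hτ.1 _ (hτd hτ) {a | ∑ u, z u * w u - ε ≤ ∑ u, a u * w u}
    (isClosed_le continuous_const hlin) ?_ ?_
  · refine convex_halfSpace_ge (𝕜 := ℝ) (f := fun a : N → ℝ => ∑ u, a u * w u) ⟨?_, ?_⟩ _
    · intro a b
      simp only [Pi.add_apply, add_mul, Finset.sum_add_distrib]
    · intro c a
      simp only [Pi.smul_apply, smul_eq_mul, mul_assoc, Finset.mul_sum]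
  · have hdist : Continuous fun p => ∑ u, |expectedGain f p u - w u| :=
      continuous_finsetSum _ fun u _ => ((continuous_expectedGain f u).sub continuous_const).abs
    have hsmall := hdist.tendsto (y τ)
    simp only [hw, sub_self, abs_zero, Finset.sum_const_zero] at hsmall
    filter_upwards [hsmall.eventually (gt_mem_nhds (half_pos hε))] with p hp
    have hdiff : ∀ a : N → ℝ, (∀ u, a u ∈ Set.Icc (0 : ℝ) 1) →
        |∑ u, a u * expectedGain f p u - ∑ u, a u * w u| < ε / 2 := by
      intro a ha
      refine lt_of_le_of_lt ?_ hp
      rw [← Finset.sum_sub_distrib]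
      refine (Finset.abs_sum_le_sum_abs _ _).trans (Finset.sum_le_sum fun u _ => ?_)
      rw [← mul_sub, abs_mul, abs_of_nonneg (ha u).1]
      exact mul_le_of_le_one_left (abs_nonneg _) (ha u).2
    have h₁ := abs_lt.1 (hdiff z hz.1.2.1)
    have h₂ := abs_lt.1 (hdiff (σ p) (hσcube p))
    have h₃ := hσmax p z hz
    show ∑ u, z u * w u - ε ≤ ∑ u, σ p u * w u
    linarith [h₁.1, h₂.2]

end GreedyExistence

/-! ### Existence and value of the runs of the algorithm. -/

section Algorithm

variable {N : Type*} [Fintype N] [DecidableEq N] {f : Finset N → ℝ} {r : N → ℝ} {k : ℕ}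

theorem exists_isFairCG1 (hmono : Monotone f) (hsub : Submodular f) (hkn : k ≤ Fintype.card N)
    (hne : (fairPolytope r k).Nonempty) :
    ∃ μ : Measure (ℕ → Finset N), IsFairCG1 f r k μ := by
  obtain ⟨y, hy⟩ := exists_isGreedyPath hmono hkn hne
  have hcube := hy.mem_cube (τ := 1) ⟨zero_le_one, le_rfl⟩
  obtain ⟨ν, hν⟩ := exists_depRounding hcube (k := k) (by exact_mod_cast hy.sum_one)
  have := (hν.isProbabilityMeasure_and_le_integral hsub hcube).1
  refine ⟨Measure.infinitePi fun _ => ν, inferInstance,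
    iIndepFun_infinitePi (X := fun _ S => S) fun _ => measurable_id, y, hy, fun t => ?_⟩
  rw [Measure.infinitePi_map_eval]
  exact hν

theorem IsFairCG1.exists_le_avgUtility (hsub : Submodular f) {μ : Measure (ℕ → Finset N)}
    (hμ : IsFairCG1 f r k μ) :
    ∃ y, IsGreedyPath f r k y ∧ multilinearExt f (y 1) ≤ avgUtility f μ := by
  obtain ⟨y, hy, hround⟩ := hμ.rounding
  have := hμ.isProbabilityMeasure
  have hcube := hy.mem_cube (τ := 1) ⟨zero_le_one, le_rfl⟩
  refine ⟨y, hy, ?_⟩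
  have hE : ∀ t, multilinearExt f (y 1) ≤ ∫ S, f (S t) ∂μ := fun t => by
    have h := ((hround t).isProbabilityMeasure_and_le_integral hsub hcube).2
    rwa [integral_map (measurable_pi_apply t).aemeasurable
      (measurable_of_finite f).aestronglyMeasurable] at h
  -- Only for the coboundedness side condition: a real `liminf` needs it to be bounded below.
  have hbound : ∀ t, ∫ S, f (S t) ∂μ ≤ ∑ A, |f A| := fun t => by
    have h := integral_mono (integrable_comp_coordinate f t μ)
      (integrable_const (∑ A, |f A|)) fun S => (le_abs_self _).trans
        (Finset.single_le_sum (f := fun A => |f A|) (fun A _ => abs_nonneg _)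
          (Finset.mem_univ (S t)))
    simpa using h
  refine le_liminf_of_le (IsBoundedUnder.isCoboundedUnder_ge (isBoundedUnder_of
    ⟨∑ A, |f A|, fun T => mean_le_of_forall_le
      (Finset.sum_nonneg fun A _ => abs_nonneg _) hbound⟩)) ?_
  filter_upwards [eventually_ne_atTop 0] with T hT
  exact le_mean_of_forall_le hT hE

end Algorithm

end FairSubmodular


theorem theorem2 {N : Type*} [Fintype N] [DecidableEq N] (k : ℕ) (hk : 1 ≤ k)
    (hkn : k ≤ Fintype.card N) (f : Finset N → ℝ) (hmono : Monotone f)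
    (hsub : FairSubmodular.Submodular f) (hempty : f ∅ = 0)
    (r : N → ℝ) (hr : FairSubmodular.FeasibleRequirement r k) :
    (∃ μ : MeasureTheory.Measure (ℕ → Finset N), FairSubmodular.IsFairCG1 f r k μ) ∧
    ∀ μ : MeasureTheory.Measure (ℕ → Finset N), FairSubmodular.IsFairCG1 f r k μ →
      (1 - 1 / Real.exp 1) * FairSubmodular.Uopt f r k ≤ FairSubmodular.avgUtility f μ := by
  obtain ⟨-, μ₀, hμ₀⟩ := hr
  obtain ⟨x₀, hx₀, -⟩ := hμ₀.exists_mem_fairPolytope hmono hsub hempty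
  refine ⟨FairSubmodular.exists_isFairCG1 hmono hsub hkn ⟨x₀, hx₀⟩, fun μ hμ => ?_⟩
  obtain ⟨y, hy, hle⟩ := hμ.exists_le_avgUtility hsub
  refine le_trans ?_ hle
  have hc : 0 < 1 - 1 / Real.exp 1 := by
    rw [sub_pos, div_lt_one (Real.exp_pos 1)]
    exact Real.one_lt_exp_iff.2 one_pos
  rw [mul_comm, ← le_div_iff₀ hc]
  -- `μ₀` supplies the nonemptiness that the supremum bound needs.
  refine csSup_le ⟨_, μ₀, hμ₀, rfl⟩ ?_
  rintro U ⟨ν, hν, rfl⟩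
  rw [le_div_iff₀ hc, mul_comm]
  exact hy.le_multilinearExt hmono hempty (hν.exists_mem_fairPolytope hmono hsub hempty)
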